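/- Let $\mathcal X\subseteq\mathbb R^d$ be compact, let $c:\mathcal X\times\mathcal X\to[0,\infty)$ be symmetric with $c(x,y)\le M_c$ and $|c(x,y)-c(x',y)|\le G_c\|x-x'\|$ for all $x,x',y\in\mathcal X$ (with $G_c\ge 0$), let $\gamma>0$, and fix $x_o\in\mathcal X$. For probability measures $\alpha,\beta$ on $\mathcal X$, the Sinkhorn potentials $(f_{\alpha,\beta},g_{\alpha,\beta})$ are continuous functions on $\mathcal X$ that maximize $$\int f\,d\alpha+\int g\,d\beta-\gamma\int\Big(e^{(f(x)+g(y)-c(x,y))/\gamma}-1\Big)\,d(\alpha\otimes\beta)(x,y)$$ over all $f,g\in C(\mathcal X)$, that are extended to all of $\mathcal X$ by the optimality conditions $$f(x)=-\gamma\log\int e^{(g(y)-c(x,y))/\gamma}\,d\beta(y),\qquad g(y)=-\gamma\log\int e^{(f(x)-c(x,y))/\gamma}\,d\alpha(x)\qquad(x,y\in\mathcal X),$$ and that are normalized by $f(x_o)=0$. Let $$d_{bl}(\alpha,\beta)=\sup\Big\{\Big|\int\xi\,d\alpha-\int\xi\,d\beta\Big| : \xi\in C(\mathcal X),\ \|\xi\|_\infty\le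 1,\ \xi\text{ is }1\text{-Lipschitz}\Big\}.$$ (i) For all probability measures $\alpha,\beta,\alpha',\beta'$ on $\mathcal X$, $$\|f_{\alpha,\beta}-f_{\alpha',\beta'}\|_\infty\le G_{bl}\,[d_{bl}(\alpha',\alpha)+d_{bl}(\beta',\beta)],\qquad \|g_{\alpha,\beta}-g_{\alpha',\beta'}\|_\infty\le G_{bl}\,[d_{bl}(\alpha',\alpha)+d_{bl}(\beta',\beta)],$$ where $G_{bl}=\dfrac{2\gamma e^{2M_c/\gamma}G'_{bl}}{1-\lambda^2}$, $G'_{bl}=\max\Big\{e^{3M_c/\gamma},\dfrac{2G_ce^{3M_c/\gamma}}{\gamma}\Big\}$ and $\lambda=\dfrac{e^{M_c/\gamma}-1}{e^{M_c/\gamma}+1}$. (ii) Let $\phi:\mathcal X\to\mathbb R^d$ be bounded and $\alpha$-measurable, put $T_\phi(x)=x+\phi(x)$, and suppose that the push-forward $T_{\phi\sharp}\alpha$ is a probability measure on $\mathcal X$. With $\|\phi\|_{2,\infty}=\sup_{x\in\mathcal X}\|\phi(x)\|$ and $G_T=2G_c\,e^{3M_c/\gamma}$, $$\|f_{T_{\phi\sharp}\alpha,\beta}-f_{\alpha,\beta}\|_\infty\le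 G_T\|\phi\|_{2,\infty},\qquad \|g_{T_{\phi\sharp}\alpha,\beta}-g_{\alpha,\beta}\|_\infty\le G_T\|\phi\|_{2,\infty}.$$ -/

import Mathlib

open MeasureTheory

/-- The objective of the dual of entropy-regularised optimal transport,
`⟨f, α⟩ + ⟨g, β⟩ - γ ⟨exp ((f ⊕ g - c) / γ) - 1, α ⊗ β⟩`. -/
noncomputable def dualObjective {Y : Type*} [TopologicalSpace Y] [MeasurableSpace Y]
    (c : Y → Y → ℝ) (γ : ℝ) (α β : ProbabilityMeasure Y) (f g : C(Y, ℝ)) : ℝ :=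
  (∫ x, f x ∂(α : Measure Y)) + (∫ y, g y ∂(β : Measure Y))
    - γ * ∫ p : Y × Y, (Real.exp ((f p.1 + g p.2 - c p.1 p.2) / γ) - 1)
        ∂((α : Measure Y).prod (β : Measure Y))

/-- The Sinkhorn mapping `𝒜(f, α)(y) = -γ log ∫ exp ((f x - c x y) / γ) dα(x)`. -/
noncomputable def sinkhornMap {Y : Type*} [TopologicalSpace Y] [MeasurableSpace Y]
    (c : Y → Y → ℝ) (γ : ℝ) (f : C(Y, ℝ)) (α : ProbabilityMeasure Y) (y : Y) : ℝ :=
  -γ * Real.log (∫ x, Real.exp ((f x - c x y) / γ) ∂(α : Measure Y))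

/-- `(f, g)` is the pair of Sinkhorn potentials of `(α, β)`: a maximiser of the dual problem over
continuous functions, extended from the supports to the whole space by the optimality conditions
`f = 𝒜(g, β)`, `g = 𝒜(f, α)`, and normalised by `f xₒ = 0`. -/
structure IsSinkhornPotentials {Y : Type*} [TopologicalSpace Y] [MeasurableSpace Y]
    (c : Y → Y → ℝ) (γ : ℝ) (xₒ : Y) (α β : ProbabilityMeasure Y) (f g : C(Y, ℝ)) : Prop where
  isMax : ∀ f' g' : C(Y, ℝ), dualObjective c γ α β f' g' ≤ dualObjective c γ α β f g
  eq_left : ∀ x, f x = sinkhornMap c γ g β x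
  eq_right : ∀ y, g y = sinkhornMap c γ f α y
  normalized : f xₒ = 0

/-- The functions `ξ` with `‖ξ‖_bl = max {‖ξ‖_∞, ‖ξ‖_lip} ≤ 1`. -/
def blUnitBall (Y : Type*) [PseudoMetricSpace Y] : Set C(Y, ℝ) :=
  {ξ | (∀ x, |ξ x| ≤ 1) ∧ LipschitzWith 1 ξ}

/-- The bounded-Lipschitz metric on probability measures (a supremum of numbers in `[0, 2]`). -/
noncomputable def dBL {Y : Type*} [PseudoMetricSpace Y] [MeasurableSpace Y]
    (α β : ProbabilityMeasure Y) : ℝ :=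
  ⨆ ξ : blUnitBall Y, |(∫ x, ξ.1 x ∂(α : Measure Y)) - ∫ x, ξ.1 x ∂(β : Measure Y)|

/-- `λ = (exp (M / γ) - 1) / (exp (M / γ) + 1)`. -/
noncomputable def contractionConst (M γ : ℝ) : ℝ :=
  (Real.exp (M / γ) - 1) / (Real.exp (M / γ) + 1)

/-- `G'_bl = max {exp (3M / γ), 2 G exp (3M / γ) / γ}`. -/
noncomputable def Gbl' (M G γ : ℝ) : ℝ :=
  max (Real.exp (3 * M / γ)) (2 * G * Real.exp (3 * M / γ) / γ)

/-- `G_bl = 2 γ exp (2M / γ) G'_bl / (1 - λ²)`. -/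
noncomputable def Gbl (M G γ : ℝ) : ℝ :=
  2 * γ * Real.exp (2 * M / γ) * Gbl' M G γ / (1 - contractionConst M γ ^ 2)

/-- `G_T = 2 G exp (3M / γ)`. -/
noncomputable def GT (M G γ : ℝ) : ℝ :=
  2 * G * Real.exp (3 * M / γ)

/-- `‖φ‖_{2,∞} = sup_x ‖φ x‖₂`, used for bounded `φ` only. -/
noncomputable def norm2Inf {Y : Type*} {d : ℕ} (φ : Y → EuclideanSpace ℝ (Fin d)) : ℝ :=
  ⨆ x, ‖φ x‖

/-! The potentials solve f = 𝒜(g, β), g = 𝒜(f, α), and stability comes from a contraction for this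
system. In oscillation, f ↦ 𝒜(f, α) contracts by the factor 1 - ε with ε = exp(-2M/γ)
(`softMin_contraction`): 𝒜(f, α)(y) - 𝒜(f', α)(y) is -γ log of the average of exp((f - f')/γ) under
a Gibbs measure depending on y, and each of these Gibbs measures dominates ε times any other.

Changing the measure at a fixed potential produces an error: a multiple of `dBL` by
`abs_softMin_measure_sub_le`, or a multiple of G‖φ‖ under transport. The oscillations p of f - f'
and q of g - g' then satisfy p ≤ (1 - ε) q + error and q ≤ (1 - ε) p + error. Eliminating q leaves
the factor 1 - (1 - ε)² = ε(2 - ε) in front of p, hence a bound of order 1/ε = exp(2M/γ). The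
normalisation at xₒ turns p into a sup bound for f - f', and one more application of 𝒜 bounds g -
g'. The constants obtained are at most `Gbl` and `GT`. -/

/-- The soft minimum `-γ log ∫ exp (w / γ) dμ` of `-w`. -/
noncomputable def softMin {Y : Type*} [MeasurableSpace Y] (γ : ℝ) (μ : Measure Y)
    (w : Y → ℝ) : ℝ :=
  -γ * Real.log (∫ x, Real.exp (w x / γ) ∂μ)

/-! ### The soft minimum: monotonicity and contraction of oscillations -/

section SoftMin

variable {Y : Type*} [MeasurableSpace Y] {μ : Measure Y} [IsProbabilityMeasure μ] {γ : ℝ}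

lemma integrable_exp_div_of_le {w : Y → ℝ} (hγ : 0 < γ) (hw : AEMeasurable w μ) {C : ℝ}
    (hC : ∀ x, w x ≤ C) : Integrable (fun x => Real.exp (w x / γ)) μ := by
  refine Integrable.of_bound (C := Real.exp (C / γ))
    (Real.measurable_exp.comp_aemeasurable (hw.div_const γ)).aestronglyMeasurable
    (Filter.Eventually.of_forall fun x => ?_)
  rw [Real.norm_eq_abs, Real.abs_exp]
  have := hC x
  gcongr

lemma softMin_le_softMin_add {w w' : Y → ℝ} (hγ : 0 < γ)
    (hw : Integrable (fun x => Real.exp (w x / γ)) μ)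
    (hw' : Integrable (fun x => Real.exp (w' x / γ)) μ) {δ : ℝ}
    (h : ∀ x, w x ≤ w' x + δ) : softMin γ μ w' ≤ softMin γ μ w + δ := by
  have hle : ∫ x, Real.exp (w x / γ) ∂μ ≤ Real.exp (δ / γ) * ∫ x, Real.exp (w' x / γ) ∂μ := by
    rw [← integral_const_mul]
    refine integral_mono hw (hw'.const_mul _) fun x => ?_
    change Real.exp (w x / γ) ≤ Real.exp (δ / γ) * Real.exp (w' x / γ)
    rw [← Real.exp_add, ← add_div]
    have := h x
    gcongr
    linarith
  have h1 := Real.log_le_log (integral_exp_pos hw) hle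
  rw [Real.log_mul (Real.exp_pos _).ne' (integral_exp_pos hw').ne', Real.log_exp] at h1
  have h2 := mul_le_mul_of_nonneg_left h1 hγ.le
  rw [mul_add, mul_div_cancel₀ _ hγ.ne'] at h2
  unfold softMin
  linarith

lemma abs_softMin_sub_softMin_le {w w' : Y → ℝ} (hγ : 0 < γ)
    (hw : Integrable (fun x => Real.exp (w x / γ)) μ)
    (hw' : Integrable (fun x => Real.exp (w' x / γ)) μ) {δ : ℝ}
    (h : ∀ x, |w x - w' x| ≤ δ) : |softMin γ μ w - softMin γ μ w'| ≤ δ := by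
  have h1 := softMin_le_softMin_add hγ hw hw' (δ := δ) fun x => by
    linarith [(abs_le.1 (h x)).2]
  have h2 := softMin_le_softMin_add hγ hw' hw (δ := δ) fun x => by
    linarith [(abs_le.1 (h x)).1]
  rw [abs_le]
  constructor <;> linarith

/-- Oscillations of differences of potentials contract under the soft minimum: a Birkhoff-type
estimate with Doeblin's constant. -/
lemma softMin_contraction {u u' k₁ k₂ : Y → ℝ} (hγ : 0 < γ) {M lo hi : ℝ}
    (h₁ : Integrable (fun x => Real.exp ((u x - k₁ x) / γ)) μ)
    (h₂ : Integrable (fun x => Real.exp ((u x - k₂ x) / γ)) μ)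
    (h₁' : Integrable (fun x => Real.exp ((u' x - k₁ x) / γ)) μ)
    (h₂' : Integrable (fun x => Real.exp ((u' x - k₂ x) / γ)) μ)
    (hk : ∀ x, |k₁ x - k₂ x| ≤ M) (hlo : ∀ x, lo ≤ u x - u' x) (hhi : ∀ x, u x - u' x ≤ hi) :
    (softMin γ μ (fun x => u x - k₁ x) - softMin γ μ (fun x => u' x - k₁ x))
      - (softMin γ μ (fun x => u x - k₂ x) - softMin γ μ (fun x => u' x - k₂ x))
      ≤ (1 - Real.exp (-(2 * M / γ))) * (hi - lo) := by
  have hM : 0 ≤ M := by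
    obtain ⟨x⟩ := nonempty_of_isProbabilityMeasure μ
    exact (abs_nonneg _).trans (hk x)
  set ε := Real.exp (-(2 * M / γ)) with hε
  have hε0 : 0 < ε := Real.exp_pos _
  have hε1 : ε ≤ 1 := Real.exp_le_one_iff.2 (by have : 0 ≤ 2 * M / γ := by positivity
                                                linarith)
  set A := Real.exp (lo / γ) with hA
  set P := ∫ x, Real.exp ((u' x - k₁ x) / γ) ∂μ with hP
  set Q := ∫ x, Real.exp ((u' x - k₂ x) / γ) ∂μ with hQ
  set P' := ∫ x, Real.exp ((u x - k₁ x) / γ) ∂μ with hP'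
  set Q' := ∫ x, Real.exp ((u x - k₂ x) / γ) ∂μ with hQ'
  have hP0 : 0 < P := integral_exp_pos h₁'
  have hQ0 : 0 < Q := integral_exp_pos h₂'
  have hP'0 : 0 < P' := integral_exp_pos h₁
  have hQ'0 : 0 < Q' := integral_exp_pos h₂
  have hA0 : 0 < A := Real.exp_pos _
  have hPQ : P ≤ Real.exp (M / γ) * Q := by
    rw [hP, hQ, ← integral_const_mul]
    refine integral_mono h₁' (h₂'.const_mul _) fun x => ?_
    change Real.exp _ ≤ Real.exp _ * Real.exp _
    rw [← Real.exp_add, ← add_div]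
    have := (abs_le.1 (hk x)).1
    gcongr
    linarith
  have hQA : Q' - A * Q ≤ Real.exp (M / γ) * (P' - A * P) := by
    rw [hP, hQ, hP', hQ', ← integral_const_mul, ← integral_const_mul,
      ← integral_sub h₂ (h₂'.const_mul _), ← integral_sub h₁ (h₁'.const_mul _),
      ← integral_const_mul]
    refine integral_mono (h₂.sub (h₂'.const_mul _)) ((h₁.sub (h₁'.const_mul _)).const_mul _)
      fun x => ?_
    change Real.exp ((u x - k₂ x) / γ) - A * Real.exp ((u' x - k₂ x) / γ) ≤
      Real.exp (M / γ) * (Real.exp ((u x - k₁ x) / γ) - A * Real.exp ((u' x - k₁ x) / γ))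
    have e1 : ∀ k : ℝ, Real.exp ((u x - k) / γ) =
        Real.exp ((u x - u' x) / γ) * Real.exp ((u' x - k) / γ) := fun k => by
      rw [← Real.exp_add]; congr 1; ring
    have h3 : Real.exp ((u' x - k₂ x) / γ) ≤ Real.exp (M / γ) * Real.exp ((u' x - k₁ x) / γ) := by
      rw [← Real.exp_add, ← add_div]
      have := (abs_le.1 (hk x)).2
      gcongr
      linarith
    have h4 : A ≤ Real.exp ((u x - u' x) / γ) := by
      have := hlo x
      rw [hA]; gcongr
    rw [e1 (k₁ x), e1 (k₂ x)]
    -- Both sides carry the nonnegative factor exp((u - u')/γ) - A; only the weights are compared.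
    nlinarith [mul_le_mul_of_nonneg_left h3 (sub_nonneg.2 h4)]
  have hεM : ε * (Real.exp (M / γ) * Real.exp (M / γ)) = 1 := by
    rw [hε, ← Real.exp_add, ← Real.exp_add, Real.exp_eq_one_iff]; ring
  have hPA : 0 ≤ P' - A * P := by
    rw [hP, hP', ← integral_const_mul, ← integral_sub h₁ (h₁'.const_mul _)]
    refine integral_nonneg fun x => ?_
    change 0 ≤ Real.exp ((u x - k₁ x) / γ) - A * Real.exp ((u' x - k₁ x) / γ)
    rw [hA, ← Real.exp_add, ← add_div, sub_nonneg]
    have := hlo x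
    gcongr
    linarith
  -- `P' / P` and `Q' / Q` average exp((u - u')/γ) ≥ A against the Gibbs weights for `k₁` and `k₂`.
  -- After subtracting A, comparing the weights costs exp(M/γ) and comparing the normalisations
  -- costs it again, hence ε.
  have hmain : ε * (Q' / Q) + (1 - ε) * A ≤ P' / P := by
    have h5 : (Q' - A * Q) * P ≤
        (Real.exp (M / γ) * Real.exp (M / γ)) * ((P' - A * P) * Q) :=
      calc (Q' - A * Q) * P ≤ Real.exp (M / γ) * (P' - A * P) * P := by gcongr
        _ ≤ Real.exp (M / γ) * (P' - A * P) * (Real.exp (M / γ) * Q) := by gcongr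
        _ = _ := by ring
    have h6 : ε * ((Q' - A * Q) * P) ≤ (P' - A * P) * Q := by
      have := mul_le_mul_of_nonneg_left h5 hε0.le
      rwa [← mul_assoc ε (_ * _), hεM, one_mul] at this
    have h7 : ε * (Q' / Q - A) ≤ P' / P - A := by
      rw [div_sub' hQ0.ne', div_sub' hP0.ne', ← mul_div_assoc, div_le_div_iff₀ hQ0 hP0]
      linarith
    linarith
  -- Concavity of log keeps the same convex weights, and log A = lo/γ.
  have hlog : ε * Real.log (Q' / Q) + (1 - ε) * Real.log A ≤ Real.log (P' / P) := by
    refine le_trans ?_ (Real.log_le_log (by have := div_pos hQ'0 hQ0; nlinarith) hmain)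
    exact strictConcaveOn_log_Ioi.concaveOn.2 (Set.mem_Ioi.2 (div_pos hQ'0 hQ0))
      (Set.mem_Ioi.2 hA0) hε0.le (sub_nonneg.2 hε1) (by ring)
  have hQB : Real.log (Q' / Q) ≤ hi / γ := by
    rw [Real.log_le_iff_le_exp (div_pos hQ'0 hQ0), div_le_iff₀ hQ0, hQ, hQ',
      ← integral_const_mul]
    refine integral_mono h₂ (h₂'.const_mul _) fun x => ?_
    change Real.exp _ ≤ Real.exp _ * Real.exp _
    rw [← Real.exp_add, ← add_div]
    have := hhi x
    gcongr
    linarith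
  have hgap : Real.log (Q' / Q) - Real.log (P' / P) ≤ (1 - ε) * ((hi - lo) / γ) := by
    rw [hA, Real.log_exp] at hlog
    rw [sub_div]
    nlinarith [mul_le_mul_of_nonneg_left hQB (sub_nonneg.2 hε1)]
  have := mul_le_mul_of_nonneg_left hgap hγ.le
  rw [Real.log_div hQ'0.ne' hQ0.ne', Real.log_div hP'0.ne' hP0.ne'] at this
  have e2 : γ * ((1 - ε) * ((hi - lo) / γ)) = (1 - ε) * (hi - lo) := by
    field_simp
  rw [e2] at this
  unfold softMin
  linarith

end SoftMin

/-! ### Dependence of the soft minimum on the measure -/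

section BoundedLipschitz

variable {Y : Type*} [PseudoMetricSpace Y] [MeasurableSpace Y]

lemma ContinuousMap.integrable_of_isProbabilityMeasure [CompactSpace Y] [BorelSpace Y]
    (f : C(Y, ℝ)) (μ : Measure Y) [IsProbabilityMeasure μ] : Integrable f μ :=
  Integrable.of_bound (C := ‖f‖) f.continuous.aestronglyMeasurable
    (Filter.Eventually.of_forall f.norm_coe_le_norm)

lemma abs_integral_sub_le_dBL (α β : ProbabilityMeasure Y) (ξ : blUnitBall Y) :
    |(∫ x, ξ.1 x ∂(α : Measure Y)) - ∫ x, ξ.1 x ∂(β : Measure Y)| ≤ dBL α β := by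
  refine le_ciSup (f := fun ξ : blUnitBall Y =>
    |(∫ x, ξ.1 x ∂(α : Measure Y)) - ∫ x, ξ.1 x ∂(β : Measure Y)|) ⟨2, ?_⟩ ξ
  rintro _ ⟨ζ, rfl⟩
  have hb : ∀ μ : ProbabilityMeasure Y, |∫ x, ζ.1 x ∂(μ : Measure Y)| ≤ 1 := fun μ => by
    have := norm_integral_le_of_norm_le_const (μ := (μ : Measure Y)) (f := ζ.1) (C := 1)
      (Filter.Eventually.of_forall ζ.2.1)
    simpa using this
  have := abs_sub (∫ x, ζ.1 x ∂(α : Measure Y)) (∫ x, ζ.1 x ∂(β : Measure Y))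
  have h1 := hb α
  have h2 := hb β
  change |_ - _| ≤ (2 : ℝ)
  linarith

lemma dBL_nonneg (α β : ProbabilityMeasure Y) : 0 ≤ dBL α β :=
  Real.iSup_nonneg fun _ => abs_nonneg _

lemma dBL_comm (α β : ProbabilityMeasure Y) : dBL α β = dBL β α := by
  unfold dBL
  simp_rw [abs_sub_comm]

lemma abs_integral_sub_le_mul_dBL (α β : ProbabilityMeasure Y) (h : C(Y, ℝ)) {K : ℝ}
    (hK : 0 < K) (hb : ∀ x, |h x| ≤ K) (hl : ∀ x y, |h x - h y| ≤ K * dist x y) :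
    |(∫ x, h x ∂(α : Measure Y)) - ∫ x, h x ∂(β : Measure Y)| ≤ K * dBL α β := by
  have hmem : K⁻¹ • h ∈ blUnitBall Y := by
    refine ⟨fun x => ?_, LipschitzWith.of_dist_le_mul fun x y => ?_⟩
    · rw [ContinuousMap.smul_apply, smul_eq_mul, abs_mul, abs_of_pos (inv_pos.2 hK),
        inv_mul_le_iff₀ hK, mul_one]
      exact hb x
    · rw [ContinuousMap.smul_apply, ContinuousMap.smul_apply, Real.dist_eq, smul_eq_mul,
        smul_eq_mul, ← mul_sub, abs_mul, abs_of_pos (inv_pos.2 hK), inv_mul_le_iff₀ hK,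
        NNReal.coe_one, one_mul]
      exact hl x y
  have := abs_integral_sub_le_dBL α β ⟨_, hmem⟩
  simp only [ContinuousMap.smul_apply, smul_eq_mul, integral_const_mul] at this
  rwa [← mul_sub, abs_mul, abs_of_pos (inv_pos.2 hK), inv_mul_le_iff₀ hK] at this

lemma abs_exp_sub_exp_le {a b C : ℝ} (ha : a ≤ C) (hb : b ≤ C) :
    |Real.exp a - Real.exp b| ≤ Real.exp C * |a - b| := by
  wlog hab : b ≤ a generalizing a b
  · rw [abs_sub_comm, abs_sub_comm a]
    exact this hb ha (le_of_not_ge hab)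
  rw [abs_of_nonneg (sub_nonneg.2 (Real.exp_le_exp.2 hab)), abs_of_nonneg (sub_nonneg.2 hab)]
  have h1 : Real.exp a - Real.exp b ≤ Real.exp a * (a - b) := by
    have h2 := Real.add_one_le_exp (b - a)
    have h3 : Real.exp b = Real.exp a * Real.exp (b - a) := by
      rw [← Real.exp_add]; congr 1; ring
    rw [h3]
    nlinarith [Real.exp_pos a]
  exact h1.trans (mul_le_mul_of_nonneg_right (Real.exp_le_exp.2 ha) (sub_nonneg.2 hab))

lemma abs_log_sub_log_le {a b m : ℝ} (hm : 0 < m) (ha : m ≤ a) (hb : m ≤ b) :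
    |Real.log a - Real.log b| ≤ |a - b| / m := by
  wlog hab : b ≤ a generalizing a b
  · rw [abs_sub_comm, abs_sub_comm a]
    exact this hb ha (le_of_not_ge hab)
  have ha0 := hm.trans_le ha
  have hb0 := hm.trans_le hb
  rw [abs_of_nonneg (sub_nonneg.2 (Real.log_le_log hb0 hab)), abs_of_nonneg (sub_nonneg.2 hab),
    ← Real.log_div ha0.ne' hb0.ne']
  calc Real.log (a / b) ≤ a / b - 1 := Real.log_le_sub_one_of_pos (div_pos ha0 hb0)
    _ = (a - b) / b := by field_simp
    _ ≤ (a - b) / m := div_le_div_of_nonneg_left (sub_nonneg.2 hab) hm hb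

/-- The soft minimum of a Lipschitz function is Lipschitz in the measure. -/
lemma abs_softMin_measure_sub_le [CompactSpace Y] [BorelSpace Y] [Nonempty Y]
    (α β : ProbabilityMeasure Y) {γ : ℝ} (hγ : 0 < γ)
    (w : C(Y, ℝ)) {R K : ℝ} (hosc : ∀ x y, w x - w y ≤ R)
    (hlip : ∀ x y, |w x - w y| ≤ K * dist x y) :
    |softMin γ (α : Measure Y) w - softMin γ (β : Measure Y) w|
      ≤ γ * Real.exp (R / γ) * max 1 (K / γ) * dBL α β := by
  -- The maximum C of exp(w/γ) scales its bounded-Lipschitz norm and also its lower bound C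
  -- exp(-R/γ), so C cancels when log is estimated by its Lipschitz constant above that bound.
  obtain ⟨z, -, hz⟩ := isCompact_univ.exists_isMaxOn Set.univ_nonempty w.continuous.continuousOn
  have hz' : ∀ x, w x ≤ w z := fun x => hz (Set.mem_univ x)
  set C := Real.exp (w z / γ) with hC
  have hC0 : 0 < C := Real.exp_pos _
  set N := max 1 (K / γ) with hN
  have hN1 : 1 ≤ N := le_max_left _ _
  let h : C(Y, ℝ) := ⟨fun x => Real.exp (w x / γ), by fun_prop⟩
  have hle : ∀ x, h x ≤ C := fun x => Real.exp_le_exp.2 (by have := hz' x; gcongr)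
  have hge : ∀ x, C * Real.exp (-(R / γ)) ≤ h x := fun x => by
    rw [hC, ← Real.exp_add]
    refine Real.exp_le_exp.2 ?_
    rw [← sub_eq_add_neg, ← sub_div]
    have := hosc z x
    gcongr
    linarith
  have hint := abs_integral_sub_le_mul_dBL α β h (K := C * N) (by positivity)
    (fun x => by
      rw [abs_of_pos (show 0 < h x from Real.exp_pos _)]
      exact (hle x).trans (le_mul_of_one_le_right hC0.le hN1)) (fun x y => by
      have h1 := abs_exp_sub_exp_le (a := w x / γ) (b := w y / γ) (C := w z / γ)
        (by have := hz' x; gcongr) (by have := hz' y; gcongr)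
      refine h1.trans ?_
      rw [mul_assoc, ← sub_div, abs_div, abs_of_pos hγ]
      have h2 : |w x - w y| / γ ≤ K / γ * dist x y := by
        rw [div_mul_eq_mul_div]
        have := hlip x y
        gcongr
      gcongr
      exact h2.trans (mul_le_mul_of_nonneg_right (le_max_right _ _) dist_nonneg))
  have hlow : ∀ μ : ProbabilityMeasure Y,
      C * Real.exp (-(R / γ)) ≤ ∫ x, h x ∂(μ : Measure Y) := fun μ => by
    have := integral_mono (μ := (μ : Measure Y)) (integrable_const (C * Real.exp (-(R / γ))))
      (h.integrable_of_isProbabilityMeasure _) hge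
    simpa using this
  have hlog := abs_log_sub_log_le (mul_pos hC0 (Real.exp_pos _)) (hlow α) (hlow β)
  have hfin : |Real.log (∫ x, h x ∂(α : Measure Y)) - Real.log (∫ x, h x ∂(β : Measure Y))| ≤
      Real.exp (R / γ) * N * dBL α β := by
    refine hlog.trans ((div_le_iff₀ (mul_pos hC0 (Real.exp_pos _))).2 (hint.trans_eq ?_))
    rw [Real.exp_neg]
    field_simp
  have e : softMin γ (α : Measure Y) w - softMin γ (β : Measure Y) w =
      -(γ * (Real.log (∫ x, h x ∂(α : Measure Y)) - Real.log (∫ x, h x ∂(β : Measure Y)))) := by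
    change -γ * Real.log (∫ x, h x ∂(α : Measure Y)) - -γ * Real.log (∫ x, h x ∂(β : Measure Y))
      = _
    ring
  rw [e, abs_neg, abs_mul, abs_of_pos hγ, mul_assoc, mul_assoc]
  rw [mul_assoc] at hfin
  gcongr

end BoundedLipschitz

/-! ### Lipschitz costs and the Sinkhorn map -/

lemma ContinuousMap.exists_argmin_argmax {Y : Type*} [TopologicalSpace Y] [CompactSpace Y]
    [Nonempty Y] (h : C(Y, ℝ)) : ∃ a b, ∀ x, h a ≤ h x ∧ h x ≤ h b := by
  obtain ⟨a, -, ha⟩ := isCompact_univ.exists_isMinOn Set.univ_nonempty h.continuous.continuousOn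
  obtain ⟨b, -, hb⟩ := isCompact_univ.exists_isMaxOn Set.univ_nonempty h.continuous.continuousOn
  exact ⟨a, b, fun x => ⟨ha (Set.mem_univ x), hb (Set.mem_univ x)⟩⟩

/-- A symmetric cost with values in `[0, M]` that is `G`-Lipschitz in each variable. -/
structure IsLipschitzCost {Y : Type*} [PseudoMetricSpace Y] (c : Y → Y → ℝ) (M G : ℝ) :
    Prop where
  nonneg : ∀ x y, 0 ≤ c x y
  symm : ∀ x y, c x y = c y x
  le : ∀ x y, c x y ≤ M
  lip : ∀ x x' y, |c x y - c x' y| ≤ G * dist x x'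

namespace IsLipschitzCost

variable {Y : Type*} [PseudoMetricSpace Y] {c : Y → Y → ℝ} {M G : ℝ}

lemma continuous_left (hc : IsLipschitzCost c M G) (y : Y) : Continuous fun x => c x y :=
  (LipschitzWith.of_dist_le_mul (K := G.toNNReal) fun x x' =>
    (hc.lip x x' y).trans (by gcongr; exact Real.le_coe_toNNReal G)).continuous

lemma lip_right (hc : IsLipschitzCost c M G) (x y y' : Y) :
    |c x y - c x y'| ≤ G * dist y y' := by
  rw [hc.symm x y, hc.symm x y']
  exact hc.lip y y' x

lemma abs_sub_le (hc : IsLipschitzCost c M G) (x y y' : Y) : |c x y - c x y'| ≤ M := by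
  rw [abs_le]
  constructor <;> linarith [hc.nonneg x y, hc.nonneg x y', hc.le x y, hc.le x y']

variable [CompactSpace Y] [MeasurableSpace Y] [BorelSpace Y] {γ : ℝ}

lemma integrable_exp (hc : IsLipschitzCost c M G) (hγ : 0 < γ) (f : C(Y, ℝ)) (y : Y)
    (μ : Measure Y) [IsProbabilityMeasure μ] :
    Integrable (fun x => Real.exp ((f x - c x y) / γ)) μ :=
  integrable_exp_div_of_le (w := fun x => f x - c x y) hγ
    (f.continuous.sub (hc.continuous_left y)).measurable.aemeasurable (C := ‖f‖) fun x => by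
      linarith [f.apply_le_norm x, hc.nonneg x y]

/-- Separate maps `S` and `T` cover the mixed integrand in which the potential is transported and
the cost is not. -/
lemma integrable_exp_comp (hc : IsLipschitzCost c M G) (hγ : 0 < γ) (f : C(Y, ℝ)) (y : Y)
    {μ : Measure Y} [IsProbabilityMeasure μ] {S T : Y → Y} (hS : AEMeasurable S μ)
    (hT : AEMeasurable T μ) :
    Integrable (fun x => Real.exp ((f (S x) - c (T x) y) / γ)) μ :=
  integrable_exp_div_of_le (w := fun x => f (S x) - c (T x) y) hγ
    ((f.continuous.measurable.comp_aemeasurable hS).sub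
      ((hc.continuous_left y).measurable.comp_aemeasurable hT)) (C := ‖f‖) fun x => by
      linarith [f.apply_le_norm (S x), hc.nonneg (T x) y]

lemma abs_sinkhornMap_sub_le (hc : IsLipschitzCost c M G) (hγ : 0 < γ) (f : C(Y, ℝ))
    (α : ProbabilityMeasure Y) (y y' : Y) :
    |sinkhornMap c γ f α y - sinkhornMap c γ f α y'| ≤ M :=
  abs_softMin_sub_softMin_le hγ (hc.integrable_exp hγ f y _) (hc.integrable_exp hγ f y' _)
    fun x => by
      rw [sub_sub_sub_cancel_left, abs_sub_comm]
      exact hc.abs_sub_le x y y'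

lemma abs_sinkhornMap_sub_le_mul_dist (hc : IsLipschitzCost c M G) (hγ : 0 < γ)
    (f : C(Y, ℝ)) (α : ProbabilityMeasure Y) (y y' : Y) :
    |sinkhornMap c γ f α y - sinkhornMap c γ f α y'| ≤ G * dist y y' :=
  abs_softMin_sub_softMin_le hγ (hc.integrable_exp hγ f y _) (hc.integrable_exp hγ f y' _)
    fun x => by
      rw [sub_sub_sub_cancel_left, abs_sub_comm]
      exact hc.lip_right x y y'

lemma abs_sinkhornMap_sub_sinkhornMap_le (hc : IsLipschitzCost c M G) (hγ : 0 < γ)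
    (f f' : C(Y, ℝ)) (α : ProbabilityMeasure Y) {δ : ℝ} (h : ∀ x, |f x - f' x| ≤ δ) (y : Y) :
    |sinkhornMap c γ f α y - sinkhornMap c γ f' α y| ≤ δ :=
  abs_softMin_sub_softMin_le hγ (hc.integrable_exp hγ f y _) (hc.integrable_exp hγ f' y _)
    fun x => by
      rw [sub_sub_sub_cancel_right]
      exact h x

lemma sinkhornMap_contraction (hc : IsLipschitzCost c M G) (hγ : 0 < γ) (f f' : C(Y, ℝ))
    (α : ProbabilityMeasure Y) {lo hi : ℝ} (h : ∀ x, lo ≤ f x - f' x ∧ f x - f' x ≤ hi)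
    (y y' : Y) :
    (sinkhornMap c γ f α y - sinkhornMap c γ f' α y)
      - (sinkhornMap c γ f α y' - sinkhornMap c γ f' α y')
      ≤ (1 - Real.exp (-(2 * M / γ))) * (hi - lo) :=
  softMin_contraction hγ (hc.integrable_exp hγ f y _) (hc.integrable_exp hγ f y' _)
    (hc.integrable_exp hγ f' y _) (hc.integrable_exp hγ f' y' _)
    (fun x => hc.abs_sub_le x y y') (fun x => (h x).1) fun x => (h x).2

/-- The potential and the cost each contribute M to the oscillation and G to the Lipschitz constant
of the exponent. -/
lemma abs_sinkhornMap_measure_sub_le [Nonempty Y] (hc : IsLipschitzCost c M G) (hγ : 0 < γ)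
    (f : C(Y, ℝ)) (hosc : ∀ x x', |f x - f x'| ≤ M) (hlip : ∀ x x', |f x - f x'| ≤ G * dist x x')
    (α α' : ProbabilityMeasure Y) (y : Y) :
    |sinkhornMap c γ f α y - sinkhornMap c γ f α' y|
      ≤ γ * Real.exp (2 * M / γ) * max 1 (2 * G / γ) * dBL α α' :=
  abs_softMin_measure_sub_le α α' hγ
    ⟨fun x => f x - c x y, f.continuous.sub (hc.continuous_left y)⟩
    (fun x x' => by
      change f x - c x y - (f x' - c x' y) ≤ 2 * M
      linarith [(abs_le.1 (hosc x x')).2, hc.nonneg x y, hc.le x' y])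
    (fun x x' => by
      change |f x - c x y - (f x' - c x' y)| ≤ 2 * G * dist x x'
      have h1 := abs_le.1 (hlip x x')
      have h2 := abs_le.1 (hc.lip x x' y)
      rw [abs_le]
      constructor <;> linarith)

/-! ### The Sinkhorn map under transport of the measure -/

section Transport

variable {α α' : ProbabilityMeasure Y} {T : Y → Y} {η : ℝ}

lemma sinkhornMap_map (hc : IsLipschitzCost c M G) (hT : AEMeasurable T (α : Measure Y))
    (hα' : (α' : Measure Y) = (α : Measure Y).map T) (f : C(Y, ℝ)) (y : Y) :
    sinkhornMap c γ f α' y = softMin γ (α : Measure Y) fun x => f (T x) - c (T x) y := by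
  have hcont : Continuous fun x => Real.exp ((f x - c x y) / γ) :=
    Real.continuous_exp.comp ((f.continuous.sub (hc.continuous_left y)).div_const γ)
  unfold sinkhornMap softMin
  rw [hα', integral_map hT hcont.aestronglyMeasurable]

lemma abs_sinkhornMap_map_sub_le (hc : IsLipschitzCost c M G) (hγ : 0 < γ) (hG : 0 ≤ G)
    (hT : AEMeasurable T (α : Measure Y)) (hα' : (α' : Measure Y) = (α : Measure Y).map T)
    (hη : ∀ x, dist x (T x) ≤ η) (f f' : C(Y, ℝ))
    (hlip : ∀ x x', |f' x - f' x'| ≤ G * dist x x') {s : ℝ} (hs : ∀ x, |f x - f' x| ≤ s) (y : Y) :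
    |sinkhornMap c γ f α y - sinkhornMap c γ f' α' y| ≤ s + 2 * G * η := by
  rw [hc.sinkhornMap_map hT hα']
  refine abs_softMin_sub_softMin_le hγ (hc.integrable_exp hγ f y _)
    (hc.integrable_exp_comp hγ f' y hT hT) fun x => ?_
  have h0 := abs_le.1 (hs x)
  have h1 := abs_le.1 (hlip x (T x))
  have h2 := abs_le.1 (hc.lip x (T x) y)
  have h3 := mul_le_mul_of_nonneg_left (hη x) hG
  rw [abs_le]
  constructor <;> linarith

/-- The contraction needs one cost for both potentials, so f is first compared with f' ∘ T at the
untransported cost, which widens [lo, hi] by Gη at each end. Moving the cost to `T x` then adds Gη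
at each of `y`, `y'`. -/
lemma sinkhornMap_map_contraction (hc : IsLipschitzCost c M G) (hγ : 0 < γ) (hG : 0 ≤ G)
    (hT : AEMeasurable T (α : Measure Y)) (hα' : (α' : Measure Y) = (α : Measure Y).map T)
    (hη : ∀ x, dist x (T x) ≤ η) (f f' : C(Y, ℝ))
    (hlip : ∀ x x', |f' x - f' x'| ≤ G * dist x x') {lo hi : ℝ}
    (h : ∀ x, lo ≤ f x - f' x ∧ f x - f' x ≤ hi) (y y' : Y) :
    (sinkhornMap c γ f α y - sinkhornMap c γ f' α' y)
      - (sinkhornMap c γ f α y' - sinkhornMap c γ f' α' y')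
      ≤ (1 - Real.exp (-(2 * M / γ))) * (hi - lo + 2 * G * η) + 2 * G * η := by
  have hGη : ∀ x, G * dist x (T x) ≤ G * η := fun x => mul_le_mul_of_nonneg_left (hη x) hG
  have hint := fun z => hc.integrable_exp_comp hγ f' z hT (aemeasurable_id (μ := (α : Measure Y)))
  have h1 := softMin_contraction (u := f) (u' := fun x => f' (T x)) (k₁ := fun x => c x y)
    (k₂ := fun x => c x y') (lo := lo - G * η) (hi := hi + G * η) hγ
    (hc.integrable_exp hγ f y _) (hc.integrable_exp hγ f y' _) (hint y) (hint y')
    (fun x => hc.abs_sub_le x y y')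
    (fun x => by linarith [(h x).1, hGη x, (abs_le.1 (hlip x (T x))).1])
    (fun x => by linarith [(h x).2, hGη x, (abs_le.1 (hlip x (T x))).2])
  have h2 : ∀ z, |softMin γ (α : Measure Y) (fun x => f' (T x) - c x z)
      - sinkhornMap c γ f' α' z| ≤ G * η := fun z => by
    rw [hc.sinkhornMap_map hT hα']
    refine abs_softMin_sub_softMin_le hγ (hint z) (hc.integrable_exp_comp hγ f' z hT hT)
      fun x => ?_
    rw [sub_sub_sub_cancel_left, abs_sub_comm]
    exact (hc.lip x (T x) z).trans (hGη x)
  have e : hi + G * η - (lo - G * η) = hi - lo + 2 * G * η := by ring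
  rw [e] at h1
  have h3 := (abs_le.1 (h2 y)).2
  have h4 := (abs_le.1 (h2 y')).1
  have h5 : ∀ z, sinkhornMap c γ f α z = softMin γ (α : Measure Y) fun x => f x - c x z :=
    fun _ => rfl
  rw [h5 y, h5 y']
  linarith

end Transport

end IsLipschitzCost

/-! ### Stability of the Sinkhorn potentials -/

namespace IsSinkhornPotentials

variable {Y : Type*} [PseudoMetricSpace Y] [CompactSpace Y] [MeasurableSpace Y] [BorelSpace Y]
  {c : Y → Y → ℝ} {M G γ : ℝ} {xₒ : Y} {α β α' β' : ProbabilityMeasure Y} {f g f' g' : C(Y, ℝ)}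

lemma abs_left_sub_le (h : IsSinkhornPotentials c γ xₒ α β f g) (hc : IsLipschitzCost c M G)
    (hγ : 0 < γ) (x x' : Y) : |f x - f x'| ≤ M := by
  rw [h.eq_left x, h.eq_left x']
  exact hc.abs_sinkhornMap_sub_le hγ g β x x'

lemma abs_right_sub_le (h : IsSinkhornPotentials c γ xₒ α β f g) (hc : IsLipschitzCost c M G)
    (hγ : 0 < γ) (x x' : Y) : |g x - g x'| ≤ M := by
  rw [h.eq_right x, h.eq_right x']
  exact hc.abs_sinkhornMap_sub_le hγ f α x x'

lemma left_lip (h : IsSinkhornPotentials c γ xₒ α β f g) (hc : IsLipschitzCost c M G)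
    (hγ : 0 < γ) (x x' : Y) : |f x - f x'| ≤ G * dist x x' := by
  rw [h.eq_left x, h.eq_left x']
  exact hc.abs_sinkhornMap_sub_le_mul_dist hγ g β x x'

lemma right_lip (h : IsSinkhornPotentials c γ xₒ α β f g) (hc : IsLipschitzCost c M G)
    (hγ : 0 < γ) (x x' : Y) : |g x - g x'| ≤ G * dist x x' := by
  rw [h.eq_right x, h.eq_right x']
  exact hc.abs_sinkhornMap_sub_le_mul_dist hγ f α x x'

/-- Both potentials vanish at `xₒ`, so oscillation controls the sup norm of the difference. -/
lemma abs_left_sub_left_le (h : IsSinkhornPotentials c γ xₒ α β f g)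
    (h' : IsSinkhornPotentials c γ xₒ α' β' f' g') {p : ℝ}
    (hp : ∀ x x', (f - f') x - (f - f') x' ≤ p) (x : Y) : |f x - f' x| ≤ p := by
  have h1 := hp x xₒ
  have h2 := hp xₒ x
  simp only [ContinuousMap.sub_apply, h.normalized, h'.normalized] at h1 h2
  rw [abs_le]
  constructor <;> linarith

/-- Stability of the Sinkhorn potentials in the bounded-Lipschitz metric, with a constant
that is smaller than `Gbl`. -/
lemma norm_sub_le_dBL (h : IsSinkhornPotentials c γ xₒ α β f g)
    (h' : IsSinkhornPotentials c γ xₒ α' β' f' g') (hc : IsLipschitzCost c M G) (hγ : 0 < γ)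
    {B : ℝ} (hB : B = γ * Real.exp (2 * M / γ) * max 1 (2 * G / γ)) :
    ‖f - f'‖ ≤ Real.exp (2 * M / γ) * (2 * B * (dBL α α' + dBL β β')) ∧
      ‖g - g'‖ ≤ Real.exp (2 * M / γ) * (2 * B * (dBL α α' + dBL β β')) := by
  have : Nonempty Y := ⟨xₒ⟩
  have hM : 0 ≤ M := (hc.nonneg xₒ xₒ).trans (hc.le xₒ xₒ)
  have hB0 : 0 ≤ B := by
    have : (0 : ℝ) ≤ max 1 (2 * G / γ) := zero_le_one.trans (le_max_left _ _)
    rw [hB]; positivity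
  have ha0 : 0 ≤ B * dBL α α' := mul_nonneg hB0 (dBL_nonneg _ _)
  have hb0 : 0 ≤ B * dBL β β' := mul_nonneg hB0 (dBL_nonneg _ _)
  -- The measure is changed at the primed potentials and the potential at the unprimed measures, so
  -- the two errors add up along one chain.
  have hα := fun y => abs_le.1 <| (hc.abs_sinkhornMap_measure_sub_le hγ f'
    (h'.abs_left_sub_le hc hγ) (h'.left_lip hc hγ) α α' y)
  have hβ := fun y => abs_le.1 <| (hc.abs_sinkhornMap_measure_sub_le hγ g'
    (h'.abs_right_sub_le hc hγ) (h'.right_lip hc hγ) β β' y)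
  simp only [← hB] at hα hβ
  obtain ⟨x₀, x₁, hx⟩ := (f - f').exists_argmin_argmax
  obtain ⟨y₀, y₁, hy⟩ := (g - g').exists_argmin_argmax
  have hpq := hc.sinkhornMap_contraction hγ g g' β hy x₁ x₀
  have hqp := hc.sinkhornMap_contraction hγ f f' α hx y₁ y₀
  have hf := h.abs_left_sub_left_le h' (p := (f - f') x₁ - (f - f') x₀)
    fun x x' => by linarith [(hx x).2, (hx x').1]
  set p := (f - f') x₁ - (f - f') x₀ with hp
  set q := (g - g') y₁ - (g - g') y₀ with hq
  have hp' : p ≤ (1 - Real.exp (-(2 * M / γ))) * q + 2 * (B * dBL β β') := by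
    have : p = (sinkhornMap c γ g β x₁ - sinkhornMap c γ g' β' x₁)
        - (sinkhornMap c γ g β x₀ - sinkhornMap c γ g' β' x₀) := by
      rw [hp, ContinuousMap.sub_apply, ContinuousMap.sub_apply, h.eq_left, h'.eq_left, h.eq_left,
        h'.eq_left]
    linarith [(hβ x₁).2, (hβ x₀).1]
  have hq' : q ≤ (1 - Real.exp (-(2 * M / γ))) * p + 2 * (B * dBL α α') := by
    have : q = (sinkhornMap c γ f α y₁ - sinkhornMap c γ f' α' y₁)
        - (sinkhornMap c γ f α y₀ - sinkhornMap c γ f' α' y₀) := by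
      rw [hq, ContinuousMap.sub_apply, ContinuousMap.sub_apply, h.eq_right, h'.eq_right,
        h.eq_right, h'.eq_right]
    linarith [(hα y₁).2, (hα y₀).1]
  have hg : ∀ y, |g y - g' y| ≤ p + B * dBL α α' := fun y => by
    rw [h.eq_right, h'.eq_right]
    have h1 := abs_le.1 (hc.abs_sinkhornMap_sub_sinkhornMap_le hγ f f' α hf y)
    have h2 := hα y
    rw [abs_le]
    constructor <;> linarith
  have hε1 : Real.exp (-(2 * M / γ)) ≤ 1 := by
    rw [Real.exp_le_one_iff, neg_nonpos]; positivity
  have hεinv : Real.exp (2 * M / γ) = (Real.exp (-(2 * M / γ)))⁻¹ := by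
    rw [← Real.exp_neg, neg_neg]
  have hε0 := Real.exp_pos (-(2 * M / γ))
  set ε := Real.exp (-(2 * M / γ)) with hε
  have hp0 : 0 ≤ p := (abs_nonneg _).trans (hf xₒ)
  have hfin : p + B * dBL α α' ≤
      Real.exp (2 * M / γ) * (2 * B * (dBL α α' + dBL β β')) := by
    rw [hεinv, ← div_eq_inv_mul, le_div_iff₀ hε0]
    have h1 : p ≤ (1 - ε) * ((1 - ε) * p + 2 * (B * dBL α α')) + 2 * (B * dBL β β') :=
      hp'.trans (by gcongr)
    -- With a = B · `dBL α α'`, inserting `h1` leaves the slack aε² ≥ 0.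
    have h2 : (p + B * dBL α α') * ε * (2 - ε) ≤ 2 * (B * dBL α α') + 2 * (B * dBL β β') := by
      nlinarith [mul_nonneg ha0 (sq_nonneg ε)]
    have h3 : (p + B * dBL α α') * ε ≤ (p + B * dBL α α') * ε * (2 - ε) :=
      le_mul_of_one_le_right (by positivity) (by linarith)
    linarith
  have hRHS := (add_nonneg hp0 ha0).trans hfin
  exact ⟨(ContinuousMap.norm_le _ hRHS).2 fun x => (hf x).trans (by linarith),
    (ContinuousMap.norm_le _ hRHS).2 fun y => (hg y).trans hfin⟩

/-- Stability of the Sinkhorn potentials under transport of the first measure. -/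
lemma norm_sub_le_of_map (h : IsSinkhornPotentials c γ xₒ α β f g)
    (h' : IsSinkhornPotentials c γ xₒ α' β f' g') (hc : IsLipschitzCost c M G) (hγ : 0 < γ)
    (hG : 0 ≤ G) {T : Y → Y} {η : ℝ} (hT : AEMeasurable T (α : Measure Y))
    (hα' : (α' : Measure Y) = (α : Measure Y).map T) (hη : ∀ x, dist x (T x) ≤ η) :
    ‖f - f'‖ ≤ Real.exp (2 * M / γ) * (2 * G * η) ∧
      ‖g - g'‖ ≤ Real.exp (2 * M / γ) * (2 * G * η) := by
  have : Nonempty Y := ⟨xₒ⟩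
  have hM : 0 ≤ M := (hc.nonneg xₒ xₒ).trans (hc.le xₒ xₒ)
  have hη0 : 0 ≤ η := dist_nonneg.trans (hη xₒ)
  obtain ⟨x₀, x₁, hx⟩ := (f - f').exists_argmin_argmax
  obtain ⟨y₀, y₁, hy⟩ := (g - g').exists_argmin_argmax
  have hpq := hc.sinkhornMap_contraction hγ g g' β hy x₁ x₀
  have hqp := hc.sinkhornMap_map_contraction hγ hG hT hα' hη f f' (h'.left_lip hc hγ) hx y₁ y₀
  have hf := h.abs_left_sub_left_le h' (p := (f - f') x₁ - (f - f') x₀)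
    fun x x' => by linarith [(hx x).2, (hx x').1]
  rw [← h.eq_left, ← h'.eq_left, ← h.eq_left, ← h'.eq_left, ← ContinuousMap.sub_apply,
    ← ContinuousMap.sub_apply] at hpq
  rw [← h.eq_right, ← h'.eq_right, ← h.eq_right, ← h'.eq_right, ← ContinuousMap.sub_apply,
    ← ContinuousMap.sub_apply] at hqp
  set p := (f - f') x₁ - (f - f') x₀ with hp
  set q := (g - g') y₁ - (g - g') y₀ with hq
  have hg : ∀ y, |g y - g' y| ≤ p + 2 * G * η := fun y => by
    rw [h.eq_right, h'.eq_right]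
    exact hc.abs_sinkhornMap_map_sub_le hγ hG hT hα' hη f f' (h'.left_lip hc hγ) hf y
  have hε1 : Real.exp (-(2 * M / γ)) ≤ 1 := by
    rw [Real.exp_le_one_iff, neg_nonpos]; positivity
  have hεinv : Real.exp (2 * M / γ) = (Real.exp (-(2 * M / γ)))⁻¹ := by
    rw [← Real.exp_neg, neg_neg]
  have hε0 := Real.exp_pos (-(2 * M / γ))
  set ε := Real.exp (-(2 * M / γ)) with hε
  have hp0 : 0 ≤ p := (abs_nonneg _).trans (hf xₒ)
  have hr0 : 0 ≤ 2 * G * η := by positivity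
  have hfin : p + 2 * G * η ≤ Real.exp (2 * M / γ) * (2 * G * η) := by
    rw [hεinv, ← div_eq_inv_mul, le_div_iff₀ hε0]
    -- Since β is common to both pairs, the step from q to p has no error term; in terms of p + 2Gη
    -- the factor 2 - ε then cancels exactly.
    have h1 : p ≤ (1 - ε) * ((1 - ε) * (p + 2 * G * η) + 2 * G * η) :=
      hpq.trans (by gcongr)
    have h2 : (p + 2 * G * η) * ε * (2 - ε) ≤ 2 * G * η * (2 - ε) := by
      nlinarith
    exact le_of_mul_le_mul_right h2 (by linarith)
  have hRHS := (add_nonneg hp0 hr0).trans hfin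
  exact ⟨(ContinuousMap.norm_le _ hRHS).2 fun x => (hf x).trans (by linarith),
    (ContinuousMap.norm_le _ hRHS).2 fun y => (hg y).trans hfin⟩

end IsSinkhornPotentials

/-! ### Comparison of constants, and the theorem -/

/-- There is room twice: exp(2M/γ) ≤ exp(3M/γ), and 0 < 1 - λ² ≤ 1. -/
lemma exp_mul_le_Gbl {M G γ : ℝ} (hM : 0 ≤ M) (hγ : 0 < γ) :
    Real.exp (2 * M / γ) * (2 * (γ * Real.exp (2 * M / γ) * max 1 (2 * G / γ))) ≤ Gbl M G γ := by
  have hm : 0 ≤ M / γ := by positivity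
  have h1 := Real.one_le_exp hm
  have hl0 : 0 ≤ contractionConst M γ := div_nonneg (by linarith) (by linarith)
  have hl1 : contractionConst M γ < 1 := (div_lt_one (by linarith)).2 (by linarith)
  have hmax : (1 : ℝ) ≤ max 1 (2 * G / γ) := le_max_left _ _
  have hG' : Gbl' M G γ = Real.exp (3 * M / γ) * max 1 (2 * G / γ) := by
    rw [Gbl', mul_max_of_nonneg _ _ (Real.exp_pos _).le, mul_one]
    congr 1
    ring
  have hden : 0 < 1 - contractionConst M γ ^ 2 := by nlinarith
  have hexp : Real.exp (2 * M / γ) ≤ Real.exp (3 * M / γ) := by gcongr; norm_num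
  rw [Gbl, hG', le_div_iff₀ hden]
  calc _ ≤ Real.exp (2 * M / γ) * (2 * (γ * Real.exp (2 * M / γ) * max 1 (2 * G / γ))) :=
        mul_le_of_le_one_right (by positivity) (by nlinarith)
    _ ≤ Real.exp (2 * M / γ) * (2 * (γ * Real.exp (3 * M / γ) * max 1 (2 * G / γ))) := by gcongr
    _ = _ := by ring

/-- A displacement whose push-forward lives on `X` comes from a self-map of `X`. -/
lemma exists_selfMap_of_map_add_eq {E : Type*} [NormedAddCommGroup E] [MeasurableSpace E]
    [BorelSpace E] [SecondCountableTopology E] {X : Set E} (hX : MeasurableSet X)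
    {α α' : Measure ↥X} {φ : ↥X → E} (hφ : AEMeasurable φ α)
    (hmap : α'.map (Subtype.val : X → E) = α.map (fun x : X => (x : E) + φ x)) :
    ∃ T : X → X, AEMeasurable T α ∧ α' = α.map T ∧ ∀ x, dist x (T x) ≤ ‖φ x‖ := by
  classical
  have hemb : MeasurableEmbedding (Subtype.val : X → E) := MeasurableEmbedding.subtype_coe hX
  have hadd : AEMeasurable (fun x : X => (x : E) + φ x) α :=
    measurable_subtype_coe.aemeasurable.add hφ
  -- The push-forward hypothesis makes the second branch null; staying at `x` there keeps the
  -- displacement bound valid at every point.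
  let T : X → X := fun x => if h : (x : E) + φ x ∈ X then ⟨_, h⟩ else x
  have hmem : ∀ᵐ x : X ∂α, (x : E) + φ x ∈ X := by
    refine ae_of_ae_map (p := fun z => z ∈ X) hadd ?_
    rw [← hmap, hemb.ae_map_iff]
    exact Filter.Eventually.of_forall fun x => x.2
  have hTeq : (fun x : X => (x : E) + φ x) =ᵐ[α] Subtype.val ∘ T := by
    filter_upwards [hmem] with x hx
    simp [T, hx]
  have hT : AEMeasurable T α := (hemb.aemeasurable_comp_iff).1 (hadd.congr hTeq)
  refine ⟨T, hT, ?_, fun x => ?_⟩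
  · rw [Measure.map_congr hTeq, ← AEMeasurable.map_map_of_aemeasurable
      measurable_subtype_coe.aemeasurable hT] at hmap
    rw [← hemb.comap_map α', hmap, hemb.comap_map]
  · by_cases hx : (x : E) + φ x ∈ X
    · simp [T, hx, Subtype.dist_eq, dist_eq_norm]
    · simp [T, hx]

theorem mainTheorem7 {d : ℕ} (X : Set (EuclideanSpace ℝ (Fin d))) [CompactSpace X] (xₒ : X)
    (c : X → X → ℝ) (γ M_c G_c : ℝ) (hγ : 0 < γ) (hG : 0 ≤ G_c)
    (c_nonneg : ∀ x y, 0 ≤ c x y) (c_symm : ∀ x y, c x y = c y x)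
    (c_bdd : ∀ x y, c x y ≤ M_c)
    (c_lip : ∀ x x' y : X, |c x y - c x' y| ≤ G_c * ‖(x : EuclideanSpace ℝ (Fin d)) - x'‖) :
    -- (i) continuity in the bounded-Lipschitz metric
    (∀ (α β α' β' : ProbabilityMeasure X) (f g f' g' : C(X, ℝ)),
      IsSinkhornPotentials c γ xₒ α β f g →
      IsSinkhornPotentials c γ xₒ α' β' f' g' →
        ‖f - f'‖ ≤ Gbl M_c G_c γ * (dBL α' α + dBL β' β) ∧
        ‖g - g'‖ ≤ Gbl M_c G_c γ * (dBL α' α + dBL β' β)) ∧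
    -- (ii) continuity under `α' = (I + φ)_♯ α`, `β' = β`
    (∀ (α β α' : ProbabilityMeasure X) (φ : X → EuclideanSpace ℝ (Fin d))
      (f g f' g' : C(X, ℝ)),
      BddAbove (Set.range fun x => ‖φ x‖) →
      AEMeasurable φ (α : Measure X) →
      (α' : Measure X).map (Subtype.val : X → EuclideanSpace ℝ (Fin d)) =
        (α : Measure X).map (fun x : X => (x : EuclideanSpace ℝ (Fin d)) + φ x) →
      IsSinkhornPotentials c γ xₒ α β f g →
      IsSinkhornPotentials c γ xₒ α' β f' g' →
        ‖f' - f‖ ≤ GT M_c G_c γ * norm2Inf φ ∧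
        ‖g' - g‖ ≤ GT M_c G_c γ * norm2Inf φ) := by
  have hc : IsLipschitzCost c M_c G_c := ⟨c_nonneg, c_symm, c_bdd, fun x x' y => by
    rw [Subtype.dist_eq, dist_eq_norm]
    exact c_lip x x' y⟩
  have hM : 0 ≤ M_c := (c_nonneg xₒ xₒ).trans (c_bdd xₒ xₒ)
  refine ⟨fun α β α' β' f g f' g' h h' => ?_, fun α β α' φ f g f' g' hbdd hφ hmap h h' => ?_⟩
  · have hle : Real.exp (2 * M_c / γ) *
        (2 * (γ * Real.exp (2 * M_c / γ) * max 1 (2 * G_c / γ)) * (dBL α α' + dBL β β'))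
        ≤ Gbl M_c G_c γ * (dBL α' α + dBL β' β) := by
      rw [← mul_assoc, dBL_comm α' α, dBL_comm β' β]
      exact mul_le_mul_of_nonneg_right (exp_mul_le_Gbl hM hγ)
        (add_nonneg (dBL_nonneg _ _) (dBL_nonneg _ _))
    have hmain := h.norm_sub_le_dBL h' hc hγ rfl
    exact ⟨hmain.1.trans hle, hmain.2.trans hle⟩
  · have hX : MeasurableSet X := (isCompact_iff_compactSpace.2 ‹_›).isClosed.measurableSet
    obtain ⟨T, hT, hα', hdist⟩ := exists_selfMap_of_map_add_eq hX hφ hmap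
    have hη : ∀ x, dist x (T x) ≤ norm2Inf φ := fun x => (hdist x).trans (le_ciSup hbdd x)
    have hη0 : 0 ≤ norm2Inf φ := Real.iSup_nonneg fun _ => norm_nonneg _
    have hle : Real.exp (2 * M_c / γ) * (2 * G_c * norm2Inf φ) ≤ GT M_c G_c γ * norm2Inf φ := by
      have hexp : Real.exp (2 * M_c / γ) ≤ Real.exp (3 * M_c / γ) := by gcongr; norm_num
      calc _ ≤ Real.exp (3 * M_c / γ) * (2 * G_c * norm2Inf φ) := by gcongr
        _ = _ := by rw [GT]; ring
    have hmain := h.norm_sub_le_of_map h' hc hγ hG hT hα' hη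
    rw [norm_sub_rev f', norm_sub_rev g']
    exact ⟨hmain.1.trans hle, hmain.2.trans hle⟩
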